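/- Let $1<p<3$, $\gamma<0$ and $\tilde m>0$. For $L>0$ let $\mathbb S_L=\mathbb R\times[0,L]$ and, for complex-valued $u\in H^1(\mathbb S_L)$, let $$E_\gamma(u)=\frac12\|\nabla u\|_{L^2(\mathbb S_L)}^2+\frac{\gamma}{2}\int_0^L|u(0,y)|^2\,dy-\frac1{p+1}\|u\|_{L^{p+1}(\mathbb S_L)}^{p+1},\qquad M(u)=\|u\|_{L^2(\mathbb S_L)}^2,$$ where $u(0,\cdot)$ is the trace of $u$ on $\{0\}\times(0,L)$, given by the precise representative of $u$. Then there exists $L^{**}=L^{**}(\tilde m)>0$ (which may also depend on the fixed parameters $p$ and $\gamma$) such that for every $L>L^{**}$, every minimizer $u$ of $E_\gamma$ on $\{v\in H^1(\mathbb S_L): M(v)=\tilde mL\}$ depends on the transverse variable $y$ in a nontrivial way, that is, $u$ is not almost everywhere equal to a function of $x$ alone. -/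

import Mathlib

open MeasureTheory Set Filter Topology
open scoped ContDiff

noncomputable section

namespace FracturedStrip

/-- The (open) strip `ℝ × (0, L)`. It differs from `ℝ × [0, L]` by a null set. -/
def strip (L : ℝ) : Set (ℝ × ℝ) := univ ×ˢ Ioo 0 L

/-- `g` is the weak derivative of `u` on the open set `Ω` in the direction `e`
(for `u`, `g` locally integrable on `Ω`). -/
def IsWeakDeriv (Ω : Set (ℝ × ℝ)) (e : ℝ × ℝ) (u g : ℝ × ℝ → ℂ) : Prop :=
  ∀ φ : ℝ × ℝ → ℝ, ContDiff ℝ ∞ φ → HasCompactSupport φ → tsupport φ ⊆ Ω →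
    ∫ z in Ω, (fderiv ℝ φ z e) • u z = -∫ z in Ω, φ z • g z

/-- The complex Sobolev space `H¹(ℝ × (0, L))`: an element is a square integrable function
on the strip together with its (a.e. unique) square integrable weak partial derivatives. -/
structure H1 (L : ℝ) where
  /-- the function -/
  toFun : ℝ × ℝ → ℂ
  /-- the weak partial derivative with respect to `x` -/
  dx : ℝ × ℝ → ℂ
  /-- the weak partial derivative with respect to `y` -/
  dy : ℝ × ℝ → ℂ
  memLp_toFun : MemLp toFun 2 (volume.restrict (strip L))
  memLp_dx : MemLp dx 2 (volume.restrict (strip L))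
  memLp_dy : MemLp dy 2 (volume.restrict (strip L))
  isWeakDeriv_dx : IsWeakDeriv (strip L) (1, 0) toFun dx
  isWeakDeriv_dy : IsWeakDeriv (strip L) (0, 1) toFun dy

/-- The open Euclidean disc with centre `c` and radius `r` (the metric of `ℝ × ℝ` in Mathlib
is the sup metric). -/
def disc (c : ℝ × ℝ) (r : ℝ) : Set (ℝ × ℝ) :=
  {z | (z.1 - c.1) ^ 2 + (z.2 - c.2) ^ 2 < r ^ 2}

open Classical in
/-- The precise representative of `u` at the point `c`: the limit of the averages of `u` over
the discs centred at `c` if it exists, and `0` otherwise. -/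
def preciseRep (u : ℝ × ℝ → ℂ) (c : ℝ × ℝ) : ℂ :=
  if h : ∃ l : ℂ, Tendsto (fun r : ℝ => ⨍ z in disc c r, u z) (𝓝[>] 0) (𝓝 l) then h.choose else 0

/-- The trace `y ↦ u(0, y)`, `0 < y < L`, on the segment `{0} × (0, L)`, as the restriction of
the precise representative. For `0 < y < L` small discs about `(0, y)` lie in the strip, so
this depends only on the class of `u` in `H¹` of the strip. -/
def trace {L : ℝ} (u : H1 L) (y : ℝ) : ℂ := preciseRep u.toFun (0, y)

/-- The mass `‖u‖²` in `L²` of the strip. -/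
def mass {L : ℝ} (u : H1 L) : ℝ := ∫ z in strip L, ‖u.toFun z‖ ^ 2

/-- The energy
`½ ‖∇u‖² + (γ/2) ∫₀ᴸ |u(0,y)|² dy - (1/(p+1)) ∫ |u|^(p+1)` on the strip. -/
def energy (p γ : ℝ) {L : ℝ} (u : H1 L) : ℝ :=
  1 / 2 * (∫ z in strip L, (‖u.dx z‖ ^ 2 + ‖u.dy z‖ ^ 2))
    + γ / 2 * (∫ y in Ioo 0 L, ‖trace u y‖ ^ 2)
    - 1 / (p + 1) * (∫ z in strip L, ‖u.toFun z‖ ^ (p + 1))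

/-- `u` minimizes the energy among all functions in `H¹` of the strip with mass `m`. -/
def IsEnergyMinimizer (p γ m : ℝ) {L : ℝ} (u : H1 L) : Prop :=
  mass u = m ∧ ∀ v : H1 L, mass v = m → energy p γ u ≤ energy p γ v

/-- `u` does not depend on the transverse variable `y`: it is almost everywhere on the strip
equal to a function of `x` alone. -/
def IndependentOfY {L : ℝ} (u : H1 L) : Prop :=
  ∃ g : ℝ → ℂ, ∀ᵐ z ∂(volume.restrict (strip L)), u.toFun z = g z.1

end FracturedStrip

end

noncomputable section

namespace FracturedStrip

/-! Write `γ = -2k` and suppose a minimizer has the form `u = F(x)`. Two competitors of the same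
mass contradict this for large `L`. The first is the linear ground state `√(mt k) e^{-k|x|}`,
constant in `y`. It minimizes the quadratic part of the energy per unit length, with value `-k² mt /
2` (`IsPrimitive.norm_sq_le`). Hence `F` can only do as well if `∫|F|^(p+1)` is at least the value
`B₀` of the ground state, a bound depending neither on `L` nor on `u`. The second is `√3 (y/L)
F(x)`. Mass, `x`-derivative and trace terms are unchanged, the `y`-derivative costs only `3 mt /
(2L)`, and the nonlinear term is multiplied by `β = 3^((p+1)/2) / (p+2) > 1`
(`one_lt_sqrt_three_rpow_div`). The gain is at least `L B₀ (β - 1) / (p+1)`, which wins for large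
`L`. The remaining work is `exists_primitive_of_independentOfY`, which reduces `u` to a continuous
`F` with derivative in `L²`, and `preciseRep_eq`, which identifies the trace with `F 0`. -/

/-! ### Weak derivatives and primitives on the line. -/

/-- `G` is the weak derivative of `f` on the real line. -/
def HasWeakDeriv (f G : ℝ → ℂ) : Prop :=
  ∀ φ : ℝ → ℝ, ContDiff ℝ ∞ φ → HasCompactSupport φ →
    ∫ x, deriv φ x • f x = -∫ x, φ x • G x

/-- `F` is a primitive of `G`. -/
def IsPrimitive (F G : ℝ → ℂ) : Prop := ∀ x, F x = F 0 + ∫ t in (0 : ℝ)..x, G t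

lemma _root_.MeasureTheory.LocallyIntegrable.intervalIntegrable' {G : ℝ → ℂ}
    (hG : LocallyIntegrable G) (a b : ℝ) : IntervalIntegrable G volume a b :=
  (hG.integrableOn_isCompact isCompact_uIcc).intervalIntegrable

lemma IsPrimitive.continuous {F G : ℝ → ℂ} (h : IsPrimitive F G) (hG : LocallyIntegrable G) :
    Continuous F := by
  have : F = fun x => F 0 + ∫ t in (0 : ℝ)..x, G t := funext h
  rw [this]
  exact continuous_const.add (intervalIntegral.continuous_primitive hG.intervalIntegrable' 0)

lemma IsPrimitive.comp_neg {F G : ℝ → ℂ} (h : IsPrimitive F G) :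
    IsPrimitive (fun x => F (-x)) (fun x => -G (-x)) := by
  intro x
  simp only [neg_zero, intervalIntegral.integral_neg, intervalIntegral.integral_comp_neg]
  rw [h (-x), intervalIntegral.integral_symm]

lemma _root_.MeasureTheory.LocallyIntegrable.comp_neg' {G : ℝ → ℂ}
    (hG : LocallyIntegrable G) : LocallyIntegrable (fun x => -G (-x)) := by
  rw [locallyIntegrable_iff] at hG ⊢
  intro K hK
  have h2 : IntegrableOn (fun x => G (-x)) K := by
    have := hG (-K) hK.neg
    have := (Measure.measurePreserving_neg (volume : Measure ℝ)).integrableOn_comp_preimage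
      (Homeomorph.neg ℝ).measurableEmbedding |>.2 this
    simpa [Function.comp_def] using this
  exact h2.neg

/-- Fubini on `{0 < t ≤ x}`. This replaces integration by parts for primitives of functions that are
merely locally integrable; it is used with `w = φ'` and with `w = k e^{-kx}`. -/
lemma integral_Ioi_smul_primitive {w : ℝ → ℝ} {G : ℝ → ℂ} (hw : Measurable w)
    (hG : AEStronglyMeasurable G) (hwi : IntegrableOn w (Ioi 0))
    (hi : IntegrableOn (fun t => (∫ x in Ioi t, |w x|) * ‖G t‖) (Ioi 0)) :
    IntegrableOn (fun x => w x • ∫ t in (0 : ℝ)..x, G t) (Ioi 0) ∧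
    ∫ x in Ioi 0, w x • ∫ t in (0 : ℝ)..x, G t = ∫ t in Ioi 0, (∫ x in Ioi t, w x) • G t := by
  set μ := (volume : Measure ℝ).restrict (Ioi 0) with hμ
  let κ : ℝ → ℝ → ℂ := fun x t => (Ici t).indicator w x • G t
  have hset : ∀ t ∈ Ioi (0 : ℝ), Ioi (0 : ℝ) ∩ Ici t = Ici t := fun t ht =>
    inter_eq_right.2 fun x hx => mem_Ioi.2 (lt_of_lt_of_le (mem_Ioi.1 ht) (mem_Ici.1 hx))
  have hmeas : AEStronglyMeasurable (Function.uncurry κ) (μ.prod μ) := by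
    have h1 : AEStronglyMeasurable (fun z : ℝ × ℝ => w z.1 • G z.2) (μ.prod μ) :=
      (hw.comp measurable_fst).aestronglyMeasurable.smul (hG.restrict.comp_snd)
    have h2 : Function.uncurry κ = {z : ℝ × ℝ | z.2 ≤ z.1}.indicator
        (fun z : ℝ × ℝ => w z.1 • G z.2) := by
      ext ⟨x, t⟩
      by_cases h : t ≤ x <;> simp [κ, Function.uncurry, indicator, h]
    rw [h2]
    exact h1.indicator (measurableSet_le measurable_snd measurable_fst)
  have hint : Integrable (Function.uncurry κ) (μ.prod μ) := by
    rw [integrable_prod_iff' hmeas]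
    constructor
    · refine Eventually.of_forall fun t => ?_
      exact (Integrable.indicator hwi measurableSet_Ici).smul_const (G t)
    · refine hi.congr ?_
      filter_upwards [ae_restrict_mem measurableSet_Ioi] with t ht
      have : ∀ x, ‖Function.uncurry κ (x, t)‖ = (Ici t).indicator (fun x => |w x|) x * ‖G t‖ := by
        intro x
        by_cases h : t ≤ x <;> simp [κ, Function.uncurry, indicator, h]
      simp only [this]
      rw [integral_mul_const, hμ, setIntegral_indicator measurableSet_Ici, hset t ht,
        integral_Ici_eq_integral_Ioi]
  have hleft : ∀ x ∈ Ioi (0 : ℝ), ∫ t, κ x t ∂μ = w x • ∫ t in (0 : ℝ)..x, G t := by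
    intro x hx
    have : ∀ t, κ x t = (Iic x).indicator (fun t => w x • G t) t := by
      intro t
      by_cases h : t ≤ x <;> simp [κ, indicator, h]
    simp only [this]
    rw [hμ, setIntegral_indicator measurableSet_Iic, Ioi_inter_Iic, integral_smul,
      intervalIntegral.integral_of_le (le_of_lt hx)]
  constructor
  · refine hint.integral_prod_left.congr ?_
    filter_upwards [ae_restrict_mem measurableSet_Ioi] with x hx using hleft x hx
  · rw [← setIntegral_congr_fun measurableSet_Ioi hleft, integral_integral_swap hint]
    refine setIntegral_congr_fun measurableSet_Ioi fun t ht => ?_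
    simp only [κ]
    rw [integral_smul_const, hμ, setIntegral_indicator measurableSet_Ici, hset t ht,
        integral_Ici_eq_integral_Ioi]

lemma IsPrimitive.integral_Ioi_deriv_smul {F G : ℝ → ℂ} (h : IsPrimitive F G)
    (hG : LocallyIntegrable G) {φ : ℝ → ℝ} (hφ : ContDiff ℝ ∞ φ) (hc : HasCompactSupport φ) :
    ∫ x in Ioi 0, deriv φ x • F x = -(φ 0 • F 0) - ∫ x in Ioi 0, φ x • G x := by
  have hφ1 : ContDiff ℝ 1 φ := hφ.of_le (by exact_mod_cast le_top)
  have hd : Continuous (deriv φ) := hφ1.continuous_deriv le_rfl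
  have hdi : Integrable (deriv φ) := hd.integrable_of_hasCompactSupport hc.deriv
  obtain ⟨R, hR⟩ : ∃ R : ℝ, tsupport (deriv φ) ⊆ Metric.closedBall 0 R :=
    hc.deriv.isCompact.isBounded.subset_closedBall 0
  have hz : ∀ t, R < t → ∫ x in Ioi t, |deriv φ x| = 0 := by
    intro t ht
    refine setIntegral_eq_zero_of_forall_eq_zero fun x hx => ?_
    have : x ∉ tsupport (deriv φ) := fun hx' => by
      have := hR hx'
      rw [Metric.mem_closedBall, dist_zero_right, Real.norm_eq_abs] at this
      have := le_abs_self x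
      have : t < x := hx
      linarith
    simp [image_eq_zero_of_notMem_tsupport this]
  -- The tail of `|φ'|` vanishes beyond `R`, so only the integrability of `G` on `[0, R]` matters.
  have hi : IntegrableOn (fun t => (∫ x in Ioi t, |deriv φ x|) * ‖G t‖) (Ioi 0) := by
    have h1 : Integrable ((Icc 0 R).indicator fun t => (∫ x, |deriv φ x|) * ‖G t‖) :=
      IntegrableOn.integrable_indicator
        ((hG.integrableOn_isCompact isCompact_Icc).norm.const_mul _) measurableSet_Icc
    refine h1.integrableOn.mono' ?_ ?_
    · refine AEStronglyMeasurable.mul ?_ hG.aestronglyMeasurable.norm.restrict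
      have : Antitone fun t => ∫ x in Ioi t, |deriv φ x| := fun s t hst =>
        setIntegral_mono_set hdi.abs.integrableOn (Eventually.of_forall fun _ => abs_nonneg _)
          (Ioi_subset_Ioi hst).eventuallyLE
      exact this.measurable.aestronglyMeasurable
    · filter_upwards [ae_restrict_mem measurableSet_Ioi] with t ht
      have h0 : 0 ≤ ∫ x in Ioi t, |deriv φ x| := integral_nonneg fun _ => abs_nonneg _
      rw [Real.norm_of_nonneg (mul_nonneg h0 (norm_nonneg _))]
      by_cases htR : t ≤ R
      · rw [indicator_of_mem (mem_Icc.2 ⟨le_of_lt ht, htR⟩)]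
        exact mul_le_mul_of_nonneg_right (setIntegral_le_integral hdi.abs
          (Eventually.of_forall fun _ => abs_nonneg _)) (norm_nonneg _)
      · rw [hz t (not_le.1 htR), zero_mul]
        exact indicator_nonneg (fun x _ => mul_nonneg
          (integral_nonneg fun _ => abs_nonneg _) (norm_nonneg _)) _
  obtain ⟨hint, heq⟩ := integral_Ioi_smul_primitive hd.measurable hG.aestronglyMeasurable
    hdi.integrableOn hi
  have hsplit : ∀ x, deriv φ x • F x = deriv φ x • F 0 + deriv φ x • ∫ t in (0 : ℝ)..x, G t := by
    intro x
    rw [← smul_add, ← h x]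
  simp only [hsplit]
  rw [integral_add (hdi.integrableOn.smul_const _) hint, heq, integral_smul_const,
    hc.integral_Ioi_deriv_eq hφ1]
  simp only [hc.integral_Ioi_deriv_eq hφ1, neg_smul, integral_neg, sub_eq_add_neg]

lemma IsPrimitive.hasWeakDeriv {F G : ℝ → ℂ} (h : IsPrimitive F G)
    (hG : LocallyIntegrable G) : HasWeakDeriv F G := by
  intro φ hφ hc
  have hφ1 : ContDiff ℝ 1 φ := hφ.of_le (by exact_mod_cast le_top)
  have hd : Continuous (deriv φ) := hφ1.continuous_deriv le_rfl
  have hI1 : Integrable fun x => deriv φ x • F x :=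
    (h.continuous hG).locallyIntegrable.integrable_smul_left_of_hasCompactSupport hd hc.deriv
  have hI2 : Integrable fun x => φ x • G x :=
    hG.integrable_smul_left_of_hasCompactSupport hφ.continuous hc
  -- The negative half-line follows by reflection; the boundary terms at `0` then cancel.
  have hneg := h.comp_neg.integral_Ioi_deriv_smul hG.comp_neg' (hφ.comp contDiff_neg)
    (hc.comp_homeomorph (Homeomorph.neg ℝ))
  have e1 : ∀ x, deriv (φ ∘ fun x => -x) x = -deriv φ (-x) := fun x => deriv_comp_neg φ x
  simp only [e1, Function.comp_apply, neg_smul, smul_neg, integral_neg, neg_zero] at hneg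
  rw [integral_comp_neg_Ioi (0 : ℝ) (fun x => deriv φ x • F x),
    integral_comp_neg_Ioi (0 : ℝ) (fun x => φ x • G x), neg_zero] at hneg
  rw [← intervalIntegral.integral_Iic_add_Ioi hI1.integrableOn hI1.integrableOn (b := 0),
    ← intervalIntegral.integral_Iic_add_Ioi hI2.integrableOn hI2.integrableOn (b := 0),
    h.integral_Ioi_deriv_smul hG hφ hc, neg_eq_iff_eq_neg.1 hneg]
  ring

lemma exists_contDiff_integral_eq_one :
    ∃ η : ℝ → ℝ, ContDiff ℝ ∞ η ∧ HasCompactSupport η ∧ ∫ x, η x = 1 := by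
  let b : ContDiffBump (0 : ℝ) := ⟨1, 2, one_pos, one_lt_two⟩
  exact ⟨b.normed volume, b.contDiff_normed, b.hasCompactSupport_normed, b.integral_normed⟩

/-- A smooth compactly supported function with zero integral is the derivative of another one. -/
lemma exists_hasCompactSupport_deriv_eq {θ : ℝ → ℝ} (hθ : ContDiff ℝ ∞ θ)
    (hc : HasCompactSupport θ) (h0 : ∫ x, θ x = 0) :
    ∃ ψ : ℝ → ℝ, ContDiff ℝ ∞ ψ ∧ HasCompactSupport ψ ∧ deriv ψ = θ := by
  obtain ⟨R, hR⟩ : ∃ R : ℝ, tsupport θ ⊆ Metric.closedBall 0 R :=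
    hc.isCompact.isBounded.subset_closedBall 0
  have hz : ∀ x, x ∉ Icc (-R) R → θ x = 0 := fun x hx => by
    refine image_eq_zero_of_notMem_tsupport fun h => hx ?_
    have := hR h
    rwa [Metric.mem_closedBall, dist_zero_right, Real.norm_eq_abs, abs_le] at this
  have hi : Integrable θ := hθ.continuous.integrable_of_hasCompactSupport hc
  -- Integrating from `-∞` gives zero to the left of the support; the zero mean gives zero to its
  -- right.
  let ψ : ℝ → ℝ := fun x => ∫ t in Iic x, θ t
  have hd : ∀ x, HasDerivAt ψ (θ x) x := by
    intro x
    have h1 : ψ = fun x => (∫ t in Iic (0 : ℝ), θ t) + ∫ t in (0 : ℝ)..x, θ t := by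
      ext x
      have := intervalIntegral.integral_Iic_sub_Iic (f := θ) (μ := volume) (a := 0) (b := x)
        hi.integrableOn hi.integrableOn
      simp only [ψ]
      linarith
    rw [h1]
    exact (hθ.continuous.integral_hasStrictDerivAt 0 x).hasDerivAt.const_add _
  have hdd : deriv ψ = θ := funext fun x => (hd x).deriv
  refine ⟨ψ, ?_, ?_, hdd⟩
  · rw [contDiff_infty_iff_deriv, hdd]
    exact ⟨fun x => (hd x).differentiableAt, hθ⟩
  · refine HasCompactSupport.intro (isCompact_Icc (a := -R) (b := R)) fun x hx => ?_
    by_cases hx1 : x < -R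
    · exact setIntegral_eq_zero_of_forall_eq_zero fun t ht =>
        hz t fun h => by linarith [h.1, show t ≤ x from ht]
    · have hx2 : R < x := by
        by_contra h
        exact hx ⟨not_lt.1 hx1, not_lt.1 h⟩
      have := intervalIntegral.integral_Iic_add_Ioi (f := θ) (μ := volume) (b := x)
        hi.integrableOn hi.integrableOn
      rw [h0, setIntegral_eq_zero_of_forall_eq_zero (t := Ioi x) fun t ht =>
        hz t fun h => by linarith [h.2, show x < t from ht], add_zero] at this
      exact this

/-- The du Bois-Reymond lemma. -/
lemma ae_eq_const_of_integral_deriv_smul_eq_zero {D : ℝ → ℂ} (hD : LocallyIntegrable D)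
    (h : ∀ φ : ℝ → ℝ, ContDiff ℝ ∞ φ → HasCompactSupport φ → ∫ x, deriv φ x • D x = 0) :
    ∃ c : ℂ, ∀ᵐ x, D x = c := by
  obtain ⟨η, hη, hηc, hη1⟩ := exists_contDiff_integral_eq_one
  refine ⟨∫ x, η x • D x, ?_⟩
  set c := ∫ x, η x • D x with hcdef
  have key : ∀ᵐ x, D x - c = 0 := by
    refine ae_eq_zero_of_integral_contDiff_smul_eq_zero
      (hD.sub (locallyIntegrable_const c)) fun φ hφ hc => ?_
    have hφi : Integrable φ := hφ.continuous.integrable_of_hasCompactSupport hc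
    have hηi : Integrable η := hη.continuous.integrable_of_hasCompactSupport hηc
    -- Subtracting the multiple of `η` with the same integral makes any test function a derivative.
    have hθ : ContDiff ℝ ∞ (fun x => φ x - (∫ y, φ y) * η x) := hφ.sub (contDiff_const.mul hη)
    have hθc : HasCompactSupport (fun x => φ x - (∫ y, φ y) * η x) := hc.sub hηc.mul_left
    obtain ⟨ψ, hψ, hψc, hψd⟩ := exists_hasCompactSupport_deriv_eq hθ hθc (by
      rw [integral_sub hφi (hηi.const_mul _), integral_const_mul, hη1, mul_one, sub_self])
    have h1 := h ψ hψ hψc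
    have hφD : Integrable fun x => φ x • D x :=
      hD.integrable_smul_left_of_hasCompactSupport hφ.continuous hc
    have hηD : Integrable fun x => η x • D x :=
      hD.integrable_smul_left_of_hasCompactSupport hη.continuous hηc
    simp only [hψd, sub_smul, mul_smul] at h1
    rw [integral_sub hφD (hηD.fun_smul _), integral_smul, ← hcdef] at h1
    simp only [smul_sub]
    rw [integral_sub hφD (hφi.smul_const c), integral_smul_const, h1]
  filter_upwards [key] with x hx using sub_eq_zero.1 hx

lemma HasWeakDeriv.exists_isPrimitive {f G : ℝ → ℂ} (h : HasWeakDeriv f G)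
    (hf : LocallyIntegrable f) (hG : LocallyIntegrable G) :
    ∃ F, IsPrimitive F G ∧ f =ᵐ[volume] F := by
  have hP : IsPrimitive (fun x => ∫ t in (0 : ℝ)..x, G t) G := fun x => by simp
  have hPl := (hP.continuous hG).locallyIntegrable (μ := volume)
  obtain ⟨c, hc⟩ := ae_eq_const_of_integral_deriv_smul_eq_zero (hf.sub hPl) fun φ hφ hφc => by
    have hd : Continuous (deriv φ) :=
      (hφ.of_le (by exact_mod_cast le_top : (1 : WithTop ℕ∞) ≤ ∞)).continuous_deriv le_rfl
    simp only [Pi.sub_apply, smul_sub]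
    rw [integral_sub (hf.integrable_smul_left_of_hasCompactSupport hd hφc.deriv)
      (hPl.integrable_smul_left_of_hasCompactSupport hd hφc.deriv), h φ hφ hφc,
      hP.hasWeakDeriv hG φ hφ hφc, sub_self]
  refine ⟨fun x => c + ∫ t in (0 : ℝ)..x, G t, fun x => by simp, ?_⟩
  filter_upwards [hc] with x hx
  rw [← hx, Pi.sub_apply, sub_add_cancel]

/-! ### The sharp trace inequality on the line. -/

lemma integrableOn_exp_neg_mul {k : ℝ} (hk : 0 < k) (a : ℝ) :
    IntegrableOn (fun x => Real.exp (-k * x)) (Ioi a) :=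
  integrableOn_exp_mul_Ioi (neg_lt_zero.2 hk) a

lemma memLp_two_exp_neg_mul {k : ℝ} (hk : 0 < k) :
    MemLp (fun x : ℝ => ((Real.exp (-k * x) : ℝ) : ℂ)) 2 (volume.restrict (Ioi 0)) := by
  rw [memLp_two_iff_integrable_sq_norm (by fun_prop)]
  refine (integrableOn_exp_neg_mul (mul_pos two_pos hk) 0).congr_fun (fun x _ => ?_)
    measurableSet_Ioi
  simp only [Complex.norm_real, Real.norm_eq_abs, sq_abs, ← Real.exp_nat_mul]
  congr 1
  push_cast
  ring

lemma _root_.MeasureTheory.MemLp.integrable_norm_sq {α : Type*} [MeasurableSpace α]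
    {μ : Measure α} {f : α → ℂ} (hf : MemLp f 2 μ) : Integrable (fun x => ‖f x‖ ^ 2) μ :=
  (memLp_two_iff_integrable_sq_norm hf.1).1 hf

/-- Formally the integrand is `-(e^{-kx} F)'`. The rigorous version is the Fubini identity with
weight `k e^{-kx}`, whose tail integral is `e^{-kt}`. -/
lemma IsPrimitive.eq_integral_Ioi {F G : ℝ → ℂ} (h : IsPrimitive F G) (hF : MemLp F 2)
    (hG : MemLp G 2) {k : ℝ} (hk : 0 < k) :
    Integrable (fun x => Real.exp (-k * x) • ((k : ℂ) * F x - G x)) (volume.restrict (Ioi 0)) ∧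
    ∫ x in Ioi 0, Real.exp (-k * x) • ((k : ℂ) * F x - G x) = F 0 := by
  have hE := memLp_two_exp_neg_mul hk
  have hEF : Integrable (fun x => Real.exp (-k * x) • F x) (volume.restrict (Ioi 0)) := by
    simpa [Pi.mul_def] using hE.integrable_mul (hF.restrict (Ioi 0))
  have hEG : Integrable (fun x => Real.exp (-k * x) • G x) (volume.restrict (Ioi 0)) := by
    simpa [Pi.mul_def] using hE.integrable_mul (hG.restrict (Ioi 0))
  have htail : ∀ t, ∫ x in Ioi t, k * Real.exp (-k * x) = Real.exp (-k * t) := by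
    intro t
    rw [integral_const_mul, integral_exp_mul_Ioi (neg_lt_zero.2 hk)]
    field_simp
  have habs : ∀ x, |k * Real.exp (-k * x)| = k * Real.exp (-k * x) := fun x =>
    abs_of_pos (by positivity)
  obtain ⟨hi, heq⟩ := integral_Ioi_smul_primitive (w := fun x => k * Real.exp (-k * x)) (G := G)
    (by fun_prop) hG.1 ((integrableOn_exp_neg_mul hk 0).const_mul k) (by
      simp only [habs, htail]
      refine hEG.norm.congr (Eventually.of_forall fun x => ?_)
      simp only [norm_smul, Real.norm_of_nonneg (Real.exp_pos _).le])
  simp only [htail] at heq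
  have hs : ∀ x, Real.exp (-k * x) • ((k : ℂ) * F x - G x)
      = k • (Real.exp (-k * x) • F x) - Real.exp (-k * x) • G x := by
    intro x
    simp only [Complex.real_smul]
    ring
  have hs2 : ∀ x, k • (Real.exp (-k * x) • F x) = (k * Real.exp (-k * x)) • F 0
      + (k * Real.exp (-k * x)) • ∫ t in (0 : ℝ)..x, G t := by
    intro x
    rw [← smul_add, ← h x, mul_smul]
  have hkEF : Integrable (fun x => k • (Real.exp (-k * x) • F x)) (volume.restrict (Ioi 0)) :=
    hEF.smul k
  simp only [hs]
  refine ⟨hkEF.sub hEG, ?_⟩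
  rw [integral_sub hkEF hEG]
  simp only [hs2]
  rw [integral_add (((integrableOn_exp_neg_mul hk 0).const_mul k).smul_const _) hi, heq,
    integral_smul_const, htail]
  simp

lemma IsPrimitive.norm_sq_le_Ioi {F G : ℝ → ℂ} (h : IsPrimitive F G) (hF : MemLp F 2)
    (hG : MemLp G 2) {k : ℝ} (hk : 0 < k) :
    k * ‖F 0‖ ^ 2 ≤ ∫ x in Ioi 0, (‖G x‖ ^ 2 + k ^ 2 * ‖F x‖ ^ 2) := by
  obtain ⟨hi, heq⟩ := h.eq_integral_Ioi hF hG hk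
  set c := F 0 with hc
  -- This is `|G + k e c|² + |k F - k e c|² ≥ 0` expanded, with `e = e^{-kx}`; equality holds for
  -- the profile `F = c e`, `G = -k c e`.
  have hpt : ∀ x, 2 * k * (star c * (Real.exp (-k * x) • ((k : ℂ) * F x - G x))).re
      - 2 * k ^ 2 * ‖c‖ ^ 2 * Real.exp (-(2 * k) * x) ≤ ‖G x‖ ^ 2 + k ^ 2 * ‖F x‖ ^ 2 := by
    intro x
    have he : Real.exp (-(2 * k) * x) = Real.exp (-k * x) ^ 2 := by
      rw [← Real.exp_nat_mul]; congr 1; push_cast; ring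
    rw [he]
    set e := Real.exp (-k * x)
    simp only [← Complex.normSq_eq_norm_sq, Complex.normSq_apply]
    simp only [Complex.star_def, Complex.mul_re, Complex.conj_re, Complex.conj_im,
      Complex.smul_re, Complex.smul_im, Complex.sub_re, Complex.sub_im, Complex.ofReal_re,
      Complex.ofReal_im, Complex.mul_im, smul_eq_mul]
    nlinarith [sq_nonneg ((G x).re + k * e * c.re), sq_nonneg ((G x).im + k * e * c.im),
      sq_nonneg (k * (F x).re - k * e * c.re), sq_nonneg (k * (F x).im - k * e * c.im)]
  have hi1 : Integrable (fun x => (star c * (Real.exp (-k * x) • ((k : ℂ) * F x - G x))).re)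
      (volume.restrict (Ioi 0)) := (hi.const_mul (star c)).re
  have hi2 : Integrable (fun x => Real.exp (-(2 * k) * x)) (volume.restrict (Ioi 0)) :=
    integrableOn_exp_neg_mul (mul_pos two_pos hk) 0
  have hint : ∫ x in Ioi 0, (star c * (Real.exp (-k * x) • ((k : ℂ) * F x - G x))).re
      = ‖c‖ ^ 2 := by
    have h1 : ∫ x in Ioi 0, (star c * (Real.exp (-k * x) • ((k : ℂ) * F x - G x))).re
      = (∫ x in Ioi 0, star c * (Real.exp (-k * x) • ((k : ℂ) * F x - G x))).re :=
        integral_re (𝕜 := ℂ) (hi.const_mul (star c))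
    rw [h1, integral_const_mul, heq, ← Complex.normSq_eq_norm_sq, Complex.star_def,
      ← Complex.normSq_eq_conj_mul_self, Complex.ofReal_re]
  calc k * ‖c‖ ^ 2 = ∫ x in Ioi 0,
        (2 * k * (star c * (Real.exp (-k * x) • ((k : ℂ) * F x - G x))).re
        - 2 * k ^ 2 * ‖c‖ ^ 2 * Real.exp (-(2 * k) * x)) := by
        rw [integral_sub (hi1.const_mul _) (hi2.const_mul _), integral_const_mul,
          integral_const_mul, hint, integral_exp_mul_Ioi (by linarith)]
        simp only [mul_zero, Real.exp_zero]
        field_simp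
        ring
    _ ≤ _ := integral_mono ((hi1.const_mul _).sub (hi2.const_mul _))
        (((hG.restrict _).integrable_norm_sq).add
          (((hF.restrict _).integrable_norm_sq).const_mul _)) hpt

lemma _root_.MeasureTheory.MemLp.comp_neg' {f : ℝ → ℂ} (hf : MemLp f 2) :
    MemLp (fun x => f (-x)) 2 :=
  hf.comp_measurePreserving (Measure.measurePreserving_neg volume)

/-- The ground state energy of the linear problem with an attractive delta potential is `-k²/2`. -/
lemma IsPrimitive.norm_sq_le {F G : ℝ → ℂ} (h : IsPrimitive F G) (hF : MemLp F 2)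
    (hG : MemLp G 2) {k : ℝ} (hk : 0 < k) :
    2 * k * ‖F 0‖ ^ 2 ≤ (∫ x, ‖G x‖ ^ 2) + k ^ 2 * ∫ x, ‖F x‖ ^ 2 := by
  have h1 := h.norm_sq_le_Ioi hF hG hk
  have h2 := h.comp_neg.norm_sq_le_Ioi hF.comp_neg' hG.comp_neg'.neg hk
  have hi : Integrable fun x => ‖G x‖ ^ 2 + k ^ 2 * ‖F x‖ ^ 2 :=
    hG.integrable_norm_sq.add (hF.integrable_norm_sq.const_mul _)
  simp only [norm_neg, neg_zero] at h2
  rw [integral_comp_neg_Ioi (0 : ℝ) (fun x => ‖G x‖ ^ 2 + k ^ 2 * ‖F x‖ ^ 2), neg_zero] at h2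
  have h3 := intervalIntegral.integral_Iic_add_Ioi (b := (0 : ℝ)) hi.integrableOn hi.integrableOn
  rw [integral_add hG.integrable_norm_sq (hF.integrable_norm_sq.const_mul _),
    integral_const_mul] at h3
  linarith

/-! ### The ground state of the delta potential. -/

/-- The (unnormalized) ground state. -/
def groundState (c k x : ℝ) : ℂ := (c * Real.exp (-k * |x|) : ℝ)

/-- The derivative of the ground state. -/
def groundStateDeriv (c k x : ℝ) : ℂ :=
  ((if 0 < x then -k else k) * (c * Real.exp (-k * |x|)) : ℝ)

lemma norm_groundState {c : ℝ} (hc : 0 < c) (k x : ℝ) :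
    ‖groundState c k x‖ = c * Real.exp (-k * |x|) := by
  rw [groundState, Complex.norm_real, Real.norm_of_nonneg (by positivity)]

lemma norm_groundStateDeriv {c k : ℝ} (hk : 0 < k) (x : ℝ) :
    ‖groundStateDeriv c k x‖ = k * ‖groundState c k x‖ := by
  rw [groundStateDeriv, groundState, Complex.norm_real, Complex.norm_real, norm_mul]
  split_ifs <;> simp [abs_of_pos hk]

lemma integrable_exp_neg_mul_abs {k : ℝ} (hk : 0 < k) :
    Integrable (fun x => Real.exp (-k * |x|)) := by
  rw [← integrableOn_univ, ← Iic_union_Ioi (a := (0 : ℝ)), integrableOn_union]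
  have h : IntegrableOn (fun x => Real.exp (-k * |x|)) (Ioi 0) :=
    (integrableOn_exp_neg_mul hk 0).congr_fun
      (fun x hx => by rw [abs_of_pos (mem_Ioi.1 hx)]) measurableSet_Ioi
  refine ⟨?_, h⟩
  have := IntegrableOn.comp_neg_Iic (c := (0 : ℝ)) (f := fun x => Real.exp (-k * |x|))
    (by rw [neg_zero]; exact (integrableOn_Ici_iff_integrableOn_Ioi (μ := volume)).2 h)
  simpa using this

lemma integral_exp_neg_mul_abs {k : ℝ} (hk : 0 < k) : ∫ x, Real.exp (-k * |x|) = 2 / k := by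
  rw [integral_comp_abs (f := fun x => Real.exp (-k * x)), integral_exp_mul_Ioi (neg_lt_zero.2 hk)]
  simp [div_eq_mul_inv]

lemma norm_groundState_rpow {c : ℝ} (hc : 0 < c) (k q x : ℝ) :
    ‖groundState c k x‖ ^ q = c ^ q * Real.exp (-(q * k) * |x|) := by
  rw [norm_groundState hc, Real.mul_rpow hc.le (Real.exp_pos _).le, ← Real.exp_mul]
  ring_nf

lemma integral_norm_groundState_rpow {c k q : ℝ} (hc : 0 < c) (hk : 0 < k) (hq : 0 < q) :
    ∫ x, ‖groundState c k x‖ ^ q = c ^ q * (2 / (q * k)) := by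
  simp only [norm_groundState_rpow hc]
  rw [integral_const_mul, integral_exp_neg_mul_abs (mul_pos hq hk)]

lemma continuous_groundState (c k : ℝ) : Continuous (groundState c k) := by
  unfold groundState
  fun_prop

lemma memLp_groundState {c k : ℝ} (hc : 0 < c) (hk : 0 < k) : MemLp (groundState c k) 2 := by
  rw [memLp_two_iff_integrable_sq_norm (continuous_groundState c k).aestronglyMeasurable]
  simp only [← Real.rpow_two, norm_groundState_rpow hc]
  exact (integrable_exp_neg_mul_abs (mul_pos two_pos hk)).const_mul _

lemma measurable_groundStateDeriv (c k : ℝ) : Measurable (groundStateDeriv c k) := by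
  unfold groundStateDeriv
  refine Complex.measurable_ofReal.comp (Measurable.mul ?_ (by fun_prop))
  exact Measurable.ite measurableSet_Ioi measurable_const measurable_const

lemma memLp_groundStateDeriv {c k : ℝ} (hc : 0 < c) (hk : 0 < k) :
    MemLp (groundStateDeriv c k) 2 :=
  (memLp_groundState hc hk).of_le_mul (measurable_groundStateDeriv c k).aestronglyMeasurable
    (Eventually.of_forall fun x => (norm_groundStateDeriv hk x).le)

lemma isPrimitive_groundState (c k : ℝ) :
    IsPrimitive (groundState c k) (groundStateDeriv c k) := by
  intro x
  have hd : ∀ a t : ℝ, HasDerivAt (fun s : ℝ => ((c * Real.exp (a * s) : ℝ) : ℂ))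
      ((a * (c * Real.exp (a * t)) : ℝ) : ℂ) t := by
    intro a t
    have := (((hasDerivAt_id' t).const_mul a).exp.const_mul c).ofReal_comp
    convert this using 1
    push_cast
    ring
  have hI : ∀ a : ℝ, ∫ t in (0 : ℝ)..x, ((a * (c * Real.exp (a * t)) : ℝ) : ℂ)
      = ((c * Real.exp (a * x) : ℝ) : ℂ) - ((c * Real.exp (a * 0) : ℝ) : ℂ) := fun a =>
    intervalIntegral.integral_eq_sub_of_hasDerivAt (fun t _ => hd a t)
      (Continuous.intervalIntegrable (by fun_prop) _ _)
  rcases le_total 0 x with hx | hx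
  · have : ∫ t in (0 : ℝ)..x, groundStateDeriv c k t
        = ∫ t in (0 : ℝ)..x, ((-k * (c * Real.exp (-k * t)) : ℝ) : ℂ) := by
      refine intervalIntegral.integral_congr_ae (Eventually.of_forall fun t ht => ?_)
      rw [uIoc_of_le hx] at ht
      rw [groundStateDeriv, if_pos ht.1, abs_of_pos ht.1]
    rw [this, hI]
    simp [groundState, abs_of_nonneg hx]
  · have : ∫ t in (0 : ℝ)..x, groundStateDeriv c k t
        = ∫ t in (0 : ℝ)..x, ((k * (c * Real.exp (k * t)) : ℝ) : ℂ) := by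
      refine intervalIntegral.integral_congr_ae (Eventually.of_forall fun t ht => ?_)
      -- Here `t = 0` belongs to the interval, in agreement with the `else` branch of
      -- `groundStateDeriv`.
      rw [uIoc_of_ge hx] at ht
      rw [groundStateDeriv, if_neg (not_lt.2 ht.2), abs_of_nonpos ht.2, neg_mul_neg]
    rw [this, hI]
    simp [groundState, abs_of_nonpos hx]

/-! ### Products `h(y) F(x)` in `H¹` of the strip. -/

lemma restrict_strip (L : ℝ) : (volume : Measure (ℝ × ℝ)).restrict (strip L)
    = (volume : Measure ℝ).prod (volume.restrict (Ioo 0 L)) := by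
  rw [strip, Measure.volume_eq_prod, ← Measure.prod_restrict, Measure.restrict_univ]

lemma isOpen_strip (L : ℝ) : IsOpen (strip L) := isOpen_univ.prod isOpen_Ioo

lemma measurableSet_strip (L : ℝ) : MeasurableSet (strip L) := (isOpen_strip L).measurableSet

lemma _root_.MeasureTheory.LocallyIntegrable.comp_fst {f : ℝ → ℂ} (hf : LocallyIntegrable f)
    (ν : Measure ℝ) [IsFiniteMeasure ν] :
    LocallyIntegrable (fun z : ℝ × ℝ => f z.1) ((volume : Measure ℝ).prod ν) := by
  intro z
  obtain ⟨U, hU, hi⟩ := hf z.1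
  refine ⟨U ×ˢ univ, prod_mem_nhds hU univ_mem, ?_⟩
  rw [IntegrableOn, ← Measure.prod_restrict, Measure.restrict_univ]
  exact Integrable.comp_fst hi ν

lemma hasDerivAt_slice_left {φ : ℝ × ℝ → ℝ} (hφ : ContDiff ℝ ∞ φ) (x y : ℝ) :
    HasDerivAt (fun x => φ (x, y)) (fderiv ℝ φ (x, y) (1, 0)) x :=
  ((hφ.differentiable (by simp)).differentiableAt.hasFDerivAt (x := (x, y))).comp_hasDerivAt x
    ((hasDerivAt_id' x).prodMk (hasDerivAt_const x y))

lemma hasDerivAt_slice_right {φ : ℝ × ℝ → ℝ} (hφ : ContDiff ℝ ∞ φ) (x y : ℝ) :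
    HasDerivAt (fun y => φ (x, y)) (fderiv ℝ φ (x, y) (0, 1)) y :=
  ((hφ.differentiable (by simp)).differentiableAt.hasFDerivAt (x := (x, y))).comp_hasDerivAt y
    ((hasDerivAt_const y x).prodMk (hasDerivAt_id' y))

lemma hasCompactSupport_slice_left {φ : ℝ × ℝ → ℝ} (hc : HasCompactSupport φ) (y : ℝ) :
    HasCompactSupport fun x => φ (x, y) :=
  HasCompactSupport.intro (hc.isCompact.image continuous_fst) fun x hx =>
    image_eq_zero_of_notMem_tsupport fun h => hx ⟨(x, y), h, rfl⟩

lemma hasCompactSupport_slice_right {φ : ℝ × ℝ → ℝ} (hc : HasCompactSupport φ) (x : ℝ) :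
    HasCompactSupport fun y => φ (x, y) :=
  HasCompactSupport.intro (hc.isCompact.image continuous_snd) fun y hy =>
    image_eq_zero_of_notMem_tsupport fun h => hy ⟨(x, y), h, rfl⟩

lemma continuous_fderiv_apply' {φ : ℝ × ℝ → ℝ} (hφ : ContDiff ℝ ∞ φ) (e : ℝ × ℝ) :
    Continuous fun z => fderiv ℝ φ z e :=
  (hφ.continuous_fderiv (by simp)).clm_apply continuous_const

lemma integrable_smul_comp_fst {f : ℝ → ℂ} (hf : LocallyIntegrable f) {ψ : ℝ × ℝ → ℝ}
    (hψ : Continuous ψ) (hc : HasCompactSupport ψ) {h : ℝ → ℝ} (hh : Continuous h)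
    (ν : Measure ℝ) [IsFiniteMeasure ν] :
    Integrable (fun z : ℝ × ℝ => ψ z • h z.2 • f z.1) ((volume : Measure ℝ).prod ν) := by
  have h1 : Continuous fun z : ℝ × ℝ => ψ z * h z.2 := by fun_prop
  have h2 : HasCompactSupport fun z : ℝ × ℝ => ψ z * h z.2 := hc.mul_right
  simp only [← mul_smul]
  exact (hf.comp_fst ν).integrable_smul_left_of_hasCompactSupport h1 h2

lemma HasWeakDeriv.isWeakDeriv {f G : ℝ → ℂ} (hw : HasWeakDeriv f G) (hf : LocallyIntegrable f)
    (hG : LocallyIntegrable G) {h : ℝ → ℝ} (hh : Continuous h) (L : ℝ) :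
    IsWeakDeriv (strip L) (1, 0) (fun z => h z.2 • f z.1) (fun z => h z.2 • G z.1) := by
  intro φ hφ hc _
  rw [restrict_strip, integral_prod_symm _ (integrable_smul_comp_fst hf
    (continuous_fderiv_apply' hφ _) (hc.fderiv_apply ℝ _) hh _), integral_prod_symm _
    (integrable_smul_comp_fst hG hφ.continuous hc hh _), ← integral_neg]
  refine integral_congr_ae (Eventually.of_forall fun y => ?_)
  have h1 := hw (fun x => φ (x, y)) (hφ.comp (contDiff_id.prodMk contDiff_const))
    (hasCompactSupport_slice_left hc y)
  simp only [(hasDerivAt_slice_left hφ _ y).deriv] at h1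
  simp only [smul_comm _ (h y)]
  rw [integral_smul, integral_smul, h1, smul_neg]

lemma isWeakDeriv_snd {f : ℝ → ℂ} (hf : LocallyIntegrable f) {h h' : ℝ → ℝ}
    (hh : ∀ y, HasDerivAt h (h' y) y) (hh' : Continuous h') (L : ℝ) :
    IsWeakDeriv (strip L) (0, 1) (fun z => h z.2 • f z.1) (fun z => h' z.2 • f z.1) := by
  intro φ hφ hc hs
  have hhc : Continuous h := continuous_iff_continuousAt.2 fun y => (hh y).continuousAt
  rw [restrict_strip, integral_prod _ (integrable_smul_comp_fst hf
    (continuous_fderiv_apply' hφ _) (hc.fderiv_apply ℝ _) hhc _), integral_prod _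
    (integrable_smul_comp_fst hf hφ.continuous hc hh' _), ← integral_neg]
  refine integral_congr_ae (Eventually.of_forall fun x => ?_)
  simp only [← mul_smul]
  rw [integral_smul_const, integral_smul_const, ← neg_smul]
  congr 1
  have hy : ∀ y ∉ Ioo 0 L, (x, y) ∉ tsupport φ := fun y hy h => hy (hs h).2
  -- Since `φ` is supported in the strip, both integrals extend to the whole line, where integration
  -- by parts has no boundary terms.
  rw [setIntegral_eq_integral_of_forall_compl_eq_zero fun y h => by
      rw [show fderiv ℝ φ (x, y) = 0 from
        Function.notMem_support.1 fun h' => hy y h (support_fderiv_subset ℝ h')]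
      simp,
    setIntegral_eq_integral_of_forall_compl_eq_zero fun y h => by
      rw [image_eq_zero_of_notMem_tsupport (hy y h), zero_mul]]
  have hsc := hasCompactSupport_slice_right hc x
  have hdc := hasCompactSupport_slice_right (hc.fderiv_apply ℝ ((0 : ℝ), (1 : ℝ))) x
  have c1 : Continuous fun y => φ (x, y) := hφ.continuous.comp (by fun_prop)
  have c2 : Continuous fun y => fderiv ℝ φ (x, y) (0, 1) :=
    (continuous_fderiv_apply' hφ (0, 1)).comp (by fun_prop : Continuous fun y : ℝ => (x, y))
  have := integral_mul_deriv_eq_deriv_mul_of_integrable (u := fun y => φ (x, y)) (v := h)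
    (u' := fun y => fderiv ℝ φ (x, y) (0, 1)) (v' := h')
    (fun y _ => hasDerivAt_slice_right hφ x y) (fun y _ => hh y)
    ((c1.mul hh').integrable_of_hasCompactSupport hsc.mul_right)
    ((c2.mul hhc).integrable_of_hasCompactSupport hdc.mul_right)
    ((c1.mul hhc).integrable_of_hasCompactSupport hsc.mul_right)
  rw [this, neg_neg]

lemma memLp_smul_comp_fst {f : ℝ → ℂ} (hf : MemLp f 2) {h : ℝ → ℝ} (hh : Continuous h) (L : ℝ) :
    MemLp (fun z : ℝ × ℝ => h z.2 • f z.1) 2 (volume.restrict (strip L)) := by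
  obtain ⟨C, hC⟩ := (isCompact_Icc (a := 0) (b := L)).exists_bound_of_continuousOn hh.continuousOn
  have h1 : MemLp (fun z : ℝ × ℝ => f z.1) 2 (volume.restrict (strip L)) := by
    rw [restrict_strip]
    exact hf.comp_fst _
  refine h1.of_le_mul (c := C)
    ((hh.comp continuous_snd).aestronglyMeasurable.smul h1.1) ?_
  filter_upwards [ae_restrict_mem (measurableSet_strip L)] with z hz
  rw [norm_smul]
  exact mul_le_mul_of_nonneg_right (hC _ (Ioo_subset_Icc_self hz.2)) (norm_nonneg _)

/-- The product `F(x) h(y)` as an element of `H¹` of the strip. -/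
def productH1 (L : ℝ) {F G : ℝ → ℂ} (hP : IsPrimitive F G) (hF : MemLp F 2) (hG : MemLp G 2)
    {h h' : ℝ → ℝ} (hh : ∀ y, HasDerivAt h (h' y) y) (hh' : Continuous h') : H1 L where
  toFun z := h z.2 • F z.1
  dx z := h z.2 • G z.1
  dy z := h' z.2 • F z.1
  memLp_toFun := memLp_smul_comp_fst hF
    (continuous_iff_continuousAt.2 fun y => (hh y).continuousAt) L
  memLp_dx := memLp_smul_comp_fst hG
    (continuous_iff_continuousAt.2 fun y => (hh y).continuousAt) L
  memLp_dy := memLp_smul_comp_fst hF hh' L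
  isWeakDeriv_dx := (hP.hasWeakDeriv (hG.locallyIntegrable one_le_two)).isWeakDeriv
    (hF.locallyIntegrable one_le_two) (hG.locallyIntegrable one_le_two)
    (continuous_iff_continuousAt.2 fun y => (hh y).continuousAt) L
  isWeakDeriv_dy := isWeakDeriv_snd (hF.locallyIntegrable one_le_two) hh hh' L

/-! ### The trace and the energy of a product. -/

lemma isOpen_disc (c : ℝ × ℝ) (r : ℝ) : IsOpen (disc c r) :=
  isOpen_lt (by fun_prop) continuous_const

lemma disc_subset_ball (c : ℝ × ℝ) {r : ℝ} (hr : 0 < r) : disc c r ⊆ Metric.ball c r := by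
  intro z hz
  have hz' : (z.1 - c.1) ^ 2 + (z.2 - c.2) ^ 2 < r ^ 2 := hz
  rw [Metric.mem_ball, Prod.dist_eq, max_lt_iff, Real.dist_eq, Real.dist_eq]
  exact ⟨abs_lt_of_sq_lt_sq (by nlinarith [sq_nonneg (z.2 - c.2)]) hr.le,
    abs_lt_of_sq_lt_sq (by nlinarith [sq_nonneg (z.1 - c.1)]) hr.le⟩

/-- By continuity `W` maps small discs into a closed ball about `W c`, and by convexity the averages
stay in it. -/
lemma preciseRep_eq {Ω : Set (ℝ × ℝ)} (hΩ : IsOpen Ω) {u W : ℝ × ℝ → ℂ}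
    (huW : u =ᵐ[volume.restrict Ω] W) (hW : Continuous W) {c : ℝ × ℝ} (hc : c ∈ Ω) :
    preciseRep u c = W c := by
  have ht : Tendsto (fun r : ℝ => ⨍ z in disc c r, u z) (𝓝[>] 0) (𝓝 (W c)) := by
    rw [Metric.nhds_basis_closedBall.tendsto_right_iff]
    intro ε hε
    obtain ⟨δ, hδ, hb⟩ := Metric.mem_nhds_iff.1 (inter_mem (hΩ.mem_nhds hc)
      (hW.continuousAt.preimage_mem_nhds (Metric.closedBall_mem_nhds (W c) hε)))
    filter_upwards [Ioo_mem_nhdsGT hδ] with r hr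
    have hsub : disc c r ⊆ Metric.ball c δ :=
      (disc_subset_ball c hr.1).trans (Metric.ball_subset_ball hr.2.le)
    have hae : u =ᵐ[volume.restrict (disc c r)] W :=
      ae_restrict_of_ae_restrict_of_subset (fun z hz => (hb (hsub hz)).1) huW
    have hmem : ∀ᵐ z ∂volume.restrict (disc c r), W z ∈ Metric.closedBall (W c) ε := by
      filter_upwards [ae_restrict_mem (isOpen_disc c r).measurableSet] with z hz
        using (hb (hsub hz)).2
    rw [average_congr hae]
    refine (convex_closedBall (W c) ε).set_average_mem Metric.isClosed_closedBall ?_ ?_ hmem ?_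
    · refine ((isOpen_disc c r).measure_pos volume ⟨c, ?_⟩).ne'
      simp [disc, pow_pos hr.1]
    · exact ((measure_mono hsub).trans_lt measure_ball_lt_top).ne
    · exact (hW.locallyIntegrable.integrableOn_isCompact (isCompact_closedBall c δ)).mono_set
        (hsub.trans Metric.ball_subset_closedBall)
  have hex : ∃ l : ℂ, Tendsto (fun r : ℝ => ⨍ z in disc c r, u z) (𝓝[>] 0) (𝓝 l) := ⟨_, ht⟩
  rw [preciseRep, dif_pos hex]
  exact tendsto_nhds_unique hex.choose_spec ht

section Product

variable {L : ℝ} {w : H1 L} {F G : ℝ → ℂ} {h : ℝ → ℝ}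

/-- The factorization of the integral is unconditional, so integrability of `|F|^q` never has to be
checked. -/
lemma integral_strip_product_rpow {v : ℝ × ℝ → ℂ}
    (hv : v =ᵐ[volume.restrict (strip L)] fun z => h z.2 • F z.1) (q : ℝ) :
    ∫ z in strip L, ‖v z‖ ^ q = (∫ x, ‖F x‖ ^ q) * ∫ y in Ioo 0 L, |h y| ^ q := by
  rw [integral_congr_ae (hv.mono fun z hz => show ‖v z‖ ^ q = ‖F z.1‖ ^ q * |h z.2| ^ q by
    rw [hz, norm_smul, Real.norm_eq_abs, Real.mul_rpow (abs_nonneg _) (norm_nonneg _), mul_comm]),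
    restrict_strip, integral_prod_mul (fun x => ‖F x‖ ^ q) (fun y => |h y| ^ q)]

lemma integral_strip_product_sq {v : ℝ × ℝ → ℂ}
    (hv : v =ᵐ[volume.restrict (strip L)] fun z => h z.2 • F z.1) :
    ∫ z in strip L, ‖v z‖ ^ 2 = (∫ x, ‖F x‖ ^ 2) * ∫ y in Ioo 0 L, h y ^ 2 := by
  simpa only [Real.rpow_two, sq_abs] using integral_strip_product_rpow hv 2

/-- The `dy` term stays unevaluated, because for the minimizer only its sign is needed. -/
lemma energy_product (p γ : ℝ) (hF : Continuous F) (hh : Continuous h)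
    (hw : w.toFun =ᵐ[volume.restrict (strip L)] fun z => h z.2 • F z.1)
    (hdx : w.dx =ᵐ[volume.restrict (strip L)] fun z => h z.2 • G z.1) :
    energy p γ w = 1 / 2 * ((∫ x, ‖G x‖ ^ 2) * (∫ y in Ioo 0 L, h y ^ 2)
        + ∫ z in strip L, ‖w.dy z‖ ^ 2)
      + γ / 2 * (‖F 0‖ ^ 2 * ∫ y in Ioo 0 L, h y ^ 2)
      - 1 / (p + 1) * ((∫ x, ‖F x‖ ^ (p + 1)) * ∫ y in Ioo 0 L, |h y| ^ (p + 1)) := by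
  have htr : ∀ y ∈ Ioo 0 L, ‖trace w y‖ ^ 2 = ‖F 0‖ ^ 2 * h y ^ 2 := by
    intro y hy
    rw [trace, preciseRep_eq (isOpen_strip L) hw (by fun_prop) (mk_mem_prod (mem_univ _) hy),
      norm_smul, mul_pow, Real.norm_eq_abs, sq_abs, mul_comm]
  rw [energy, integral_add w.memLp_dx.integrable_norm_sq w.memLp_dy.integrable_norm_sq,
    integral_strip_product_sq hdx, integral_strip_product_rpow hw,
    setIntegral_congr_fun measurableSet_Ioo htr, integral_const_mul]

end Product

/-! ### Reduction of functions independent of `y` to one variable. -/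

/-- By Fubini some slice `v(·, y)` is measurable, square integrable and a.e. equal to `g`. Even the
measurability of `g` comes from this slice. -/
lemma memLp_of_ae_eq_comp_fst {L : ℝ} (hL : 0 < L) {v : ℝ × ℝ → ℂ} {g : ℝ → ℂ}
    (hv : MemLp v 2 (volume.restrict (strip L)))
    (hg : ∀ᵐ z ∂volume.restrict (strip L), v z = g z.1) : MemLp g 2 := by
  have hi := hv.integrable_norm_sq
  have hm := hv.1
  rw [restrict_strip] at hi hm hg
  have hne : NeBot (ae ((volume : Measure ℝ).restrict (Ioo 0 L))) := by
    rw [ae_neBot, Ne, Measure.restrict_eq_zero, Real.volume_Ioo]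
    simpa using hL
  have hg' := Measure.ae_ae_of_ae_prod (Measure.measurePreserving_swap.quasiMeasurePreserving.ae hg)
  have hm' := hm.prod_swap.prodMk_left
  obtain ⟨y, h1, h2, h3⟩ := (hi.prod_left_ae.and (hm'.and hg')).exists
  have hvg : (fun x => v (x, y)) =ᵐ[volume] g := h3
  exact ((memLp_two_iff_integrable_sq_norm h2).2 h1).ae_eq hvg

lemma locallyIntegrable_average {L : ℝ} {v : ℝ × ℝ → ℂ}
    (hv : MemLp v 2 (volume.restrict (strip L))) {η : ℝ → ℝ} (hη : Continuous η)
    (hc : HasCompactSupport η) :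
    LocallyIntegrable fun x => ∫ y in Ioo 0 L, η y • v (x, y) := by
  rw [locallyIntegrable_iff]
  intro K hK
  have : IsFiniteMeasure ((volume : Measure ℝ).restrict K) :=
    ⟨by rw [Measure.restrict_apply_univ]; exact hK.measure_lt_top⟩
  have h1 : Integrable v (((volume : Measure ℝ).restrict K).prod (volume.restrict (Ioo 0 L))) := by
    have := hv.restrict (K ×ˢ univ)
    rw [restrict_strip, ← Measure.prod_restrict, Measure.restrict_univ] at this
    exact this.integrable one_le_two
  obtain ⟨C, hC⟩ := hη.bounded_above_of_compact_support hc
  have h2 := h1.bdd_smul (φ := fun z : ℝ × ℝ => η z.2) C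
    (hη.comp continuous_snd).aestronglyMeasurable (Eventually.of_forall fun z => hC z.2)
  exact h2.integral_prod_left

lemma exists_contDiff_tsupport_subset_Ioo {L : ℝ} (hL : 0 < L) :
    ∃ η : ℝ → ℝ, ContDiff ℝ ∞ η ∧ HasCompactSupport η ∧ tsupport η ⊆ Ioo 0 L ∧
      ∫ y in Ioo 0 L, η y = 1 := by
  let b : ContDiffBump (L / 2) := ⟨L / 8, L / 4, by positivity, by linarith⟩
  have hs : tsupport (b.normed volume) ⊆ Ioo 0 L := by
    rw [b.tsupport_normed_eq, Real.closedBall_eq_Icc]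
    exact Icc_subset_Ioo (by change 0 < L / 2 - L / 4; linarith)
      (by change L / 2 + L / 4 < L; linarith)
  refine ⟨b.normed volume, b.contDiff_normed, b.hasCompactSupport_normed, hs, ?_⟩
  rw [setIntegral_eq_integral_of_forall_compl_eq_zero fun y hy =>
    image_eq_zero_of_notMem_tsupport fun h => hy (hs h), b.integral_normed]

/-- Test with `φ(x) η(y)`: as `η` has integral one, it disappears on the side of `u` and averages
`v` on the other. -/
lemma IsWeakDeriv.hasWeakDeriv_average {L : ℝ} {u v : ℝ × ℝ → ℂ} {f : ℝ → ℂ}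
    (huv : IsWeakDeriv (strip L) (1, 0) u v) (hv : MemLp v 2 (volume.restrict (strip L)))
    (hu : ∀ᵐ z ∂volume.restrict (strip L), u z = f z.1)
    {η : ℝ → ℝ} (hη : ContDiff ℝ ∞ η) (hηc : HasCompactSupport η) (hηs : tsupport η ⊆ Ioo 0 L)
    (hη1 : ∫ y in Ioo 0 L, η y = 1) :
    HasWeakDeriv f fun x => ∫ y in Ioo 0 L, η y • v (x, y) := by
  intro φ hφ hφc
  have hΦ : ContDiff ℝ ∞ fun z : ℝ × ℝ => φ z.1 * η z.2 :=
    (hφ.comp contDiff_fst).mul (hη.comp contDiff_snd)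
  have hzero : ∀ z : ℝ × ℝ, z ∉ tsupport φ ×ˢ tsupport η → φ z.1 * η z.2 = 0 := by
    intro z hz
    by_cases h : z.1 ∈ tsupport φ
    · rw [image_eq_zero_of_notMem_tsupport fun h' => hz (mk_mem_prod h h'), mul_zero]
    · rw [image_eq_zero_of_notMem_tsupport h, zero_mul]
  have hΦc : HasCompactSupport fun z : ℝ × ℝ => φ z.1 * η z.2 :=
    HasCompactSupport.intro (hφc.isCompact.prod hηc.isCompact) hzero
  have hΦs : tsupport (fun z : ℝ × ℝ => φ z.1 * η z.2) ⊆ strip L := by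
    refine (closure_minimal (fun z hz => ?_)
      ((isClosed_tsupport φ).prod (isClosed_tsupport η))).trans
      (prod_mono (subset_univ _) hηs)
    by_contra h
    exact hz (hzero z h)
  have hfd : ∀ z : ℝ × ℝ, fderiv ℝ (fun z : ℝ × ℝ => φ z.1 * η z.2) z (1, 0)
      = deriv φ z.1 * η z.2 := fun z =>
    (hasDerivAt_slice_left hΦ z.1 z.2).unique
      (((hφ.differentiable (by simp)).differentiableAt.hasDerivAt).mul_const (η z.2))
  have h1 := huv _ hΦ hΦc hΦs
  have hi : Integrable (fun z : ℝ × ℝ => (φ z.1 * η z.2) • v z) (volume.restrict (strip L)) :=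
    (hv.locallyIntegrable one_le_two).integrable_smul_left_of_hasCompactSupport hΦ.continuous hΦc
  have h2 : ∫ z in strip L, (deriv φ z.1 * η z.2) • u z = ∫ x, deriv φ x • f x := by
    rw [integral_congr_ae (hu.mono fun z hz => show (deriv φ z.1 * η z.2) • u z
      = (deriv φ z.1 • f z.1) * ((η z.2 : ℝ) : ℂ) by
        rw [hz, Complex.real_smul, Complex.real_smul]; push_cast; ring),
      restrict_strip, integral_prod_mul (fun x => deriv φ x • f x) (fun y => ((η y : ℝ) : ℂ)),
      integral_complex_ofReal, hη1, Complex.ofReal_one, mul_one]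
  rw [← h2]
  simp only [hfd] at h1
  rw [h1]
  rw [restrict_strip] at hi ⊢
  rw [integral_prod _ hi]
  simp only [mul_smul, integral_smul]

lemma exists_primitive_of_independentOfY {L : ℝ} (hL : 0 < L) {u : H1 L} (hu : IndependentOfY u) :
    ∃ F G : ℝ → ℂ, IsPrimitive F G ∧ MemLp F 2 ∧ MemLp G 2 ∧
      u.toFun =ᵐ[volume.restrict (strip L)] (fun z => F z.1) ∧
      u.dx =ᵐ[volume.restrict (strip L)] (fun z => G z.1) := by
  obtain ⟨f, hf⟩ := hu
  have hf2 : MemLp f 2 := memLp_of_ae_eq_comp_fst hL u.memLp_toFun hf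
  have hfl := hf2.locallyIntegrable one_le_two
  obtain ⟨η, hη, hηc, hηs, hη1⟩ := exists_contDiff_tsupport_subset_Ioo hL
  set G : ℝ → ℂ := fun x => ∫ y in Ioo 0 L, η y • u.dx (x, y) with hGdef
  have hw : HasWeakDeriv f G :=
    u.isWeakDeriv_dx.hasWeakDeriv_average u.memLp_dx hf hη hηc hηs hη1
  have hGl : LocallyIntegrable G := locallyIntegrable_average u.memLp_dx hη.continuous hηc
  have hGs : IsWeakDeriv (strip L) (1, 0) (fun z => f z.1) (fun z => G z.1) := by
    simpa using hw.isWeakDeriv hfl hGl (h := fun _ => 1) continuous_const L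
  have hGl2 : LocallyIntegrable (fun z : ℝ × ℝ => G z.1) (volume.restrict (strip L)) := by
    rw [restrict_strip]
    exact hGl.comp_fst _
  have hul := u.memLp_dx.locallyIntegrable one_le_two
  -- Both are weak `x`-derivatives of the same function. Hence `dx` is itself independent of `y`,
  -- which later puts `G` in `L²`.
  have hdx : u.dx =ᵐ[volume.restrict (strip L)] fun z => G z.1 := by
    have := (isOpen_strip L).ae_eq_zero_of_integral_contDiff_smul_eq_zero
      (locallyIntegrableOn_of_locallyIntegrable_restrict (hul.sub hGl2)) fun φ hφ hc hs => by
        have h1 := u.isWeakDeriv_dx φ hφ hc hs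
        have h2 := hGs φ hφ hc hs
        have h3 : ∫ z in strip L, fderiv ℝ φ z (1, 0) • u.toFun z
            = ∫ z in strip L, fderiv ℝ φ z (1, 0) • f z.1 :=
          integral_congr_ae (hf.mono fun z hz => by simp only [hz])
        rw [h3, h2, neg_inj] at h1
        rw [← setIntegral_eq_integral_of_forall_compl_eq_zero (s := strip L) fun z hz => by
          rw [image_eq_zero_of_notMem_tsupport fun h => hz (hs h), zero_smul]]
        simp only [Pi.sub_apply, smul_sub]
        rw [integral_sub (hul.integrable_smul_left_of_hasCompactSupport hφ.continuous hc)
          (hGl2.integrable_smul_left_of_hasCompactSupport hφ.continuous hc), h1, sub_self]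
    rw [EventuallyEq, ae_restrict_iff' (measurableSet_strip L)]
    filter_upwards [this] with z hz hzs using sub_eq_zero.1 (hz hzs)
  obtain ⟨F, hP, hfF⟩ := hw.exists_isPrimitive hfl hGl
  refine ⟨F, G, hP, hf2.ae_eq hfF, memLp_of_ae_eq_comp_fst hL u.memLp_dx hdx, ?_, hdx⟩
  have : ∀ᵐ z ∂volume.restrict (strip L), f z.1 = F z.1 := by
    rw [restrict_strip]
    exact Measure.quasiMeasurePreserving_fst.ae hfF
  filter_upwards [hf, this] with z h1 h2 using h1.trans h2

/-! ### The two competitors. -/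

lemma integral_Ioo_linear_rpow {L a q : ℝ} (hL : 0 < L) (ha : 0 ≤ a) (hq : 0 < q) :
    ∫ y in Ioo 0 L, |a / L * y| ^ q = a ^ q * L / (q + 1) := by
  have h1 : ∀ y ∈ Ioo 0 L, |a / L * y| ^ q = (a / L) ^ q * y ^ q := fun y hy => by
    rw [abs_of_nonneg (mul_nonneg (div_nonneg ha hL.le) hy.1.le),
      Real.mul_rpow (div_nonneg ha hL.le) hy.1.le]
  rw [setIntegral_congr_fun measurableSet_Ioo h1, integral_const_mul,
    ← integral_Ioc_eq_integral_Ioo, ← intervalIntegral.integral_of_le hL.le,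
    integral_rpow (Or.inl (by linarith)), Real.zero_rpow (by linarith), sub_zero,
    Real.rpow_add_one hL.ne', Real.div_rpow ha hL.le]
  have := (Real.rpow_pos_of_pos hL q).ne'
  field_simp

lemma integral_Ioo_linear_sq {L a : ℝ} (hL : 0 < L) (ha : 0 ≤ a) :
    ∫ y in Ioo 0 L, (a / L * y) ^ 2 = a ^ 2 * L / 3 := by
  have := integral_Ioo_linear_rpow hL ha two_pos
  simp only [Real.rpow_two, sq_abs] at this
  rw [this]
  norm_num

lemma integral_Ioo_const {L : ℝ} (hL : 0 < L) (c : ℝ) : ∫ _y in Ioo 0 L, c = L * c := by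
  simp [hL.le]

/-- The energy of the normalized ground state, extended constantly in `y`. -/
lemma exists_ground_state_energy {p k m L : ℝ} (hp : 1 < p) (hk : 0 < k) (hm : 0 < m)
    (hL : 0 < L) :
    ∃ w : H1 L, mass w = m * L ∧ energy p (-2 * k) w =
      L * (-(k ^ 2 * m / 2)
        - 1 / (p + 1) * (Real.sqrt (m * k) ^ (p + 1) * (2 / ((p + 1) * k)))) := by
  -- The amplitude `√(mk)` normalizes the mass, as `e^{-2k|x|}` has integral `1/k`.
  have hc : 0 < Real.sqrt (m * k) := Real.sqrt_pos.2 (mul_pos hm hk)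
  have hc2 : Real.sqrt (m * k) ^ 2 = m * k := Real.sq_sqrt (mul_pos hm hk).le
  set c := Real.sqrt (m * k)
  have hM : ∫ x, ‖groundState c k x‖ ^ 2 = m := by
    have := integral_norm_groundState_rpow hc hk two_pos
    simp only [Real.rpow_two, hc2] at this
    rw [this]
    field_simp
  have hA : ∫ x, ‖groundStateDeriv c k x‖ ^ 2 = k ^ 2 * m := by
    simp only [norm_groundStateDeriv hk, mul_pow]
    rw [integral_const_mul, hM]
  have h0 : ‖groundState c k 0‖ ^ 2 = m * k := by
    rw [norm_groundState hc]
    simp [hc2]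
  let w : H1 L := productH1 L (isPrimitive_groundState c k) (memLp_groundState hc hk)
    (memLp_groundStateDeriv hc hk) (h := fun _ => 1) (h' := fun _ => 0)
    (fun y => hasDerivAt_const y 1) continuous_const
  have hdy : ∫ z in strip L, ‖w.dy z‖ ^ 2 = 0 := by simp [w, productH1]
  refine ⟨w, ?_, ?_⟩
  · rw [mass, integral_strip_product_sq (v := w.toFun) (F := groundState c k) (h := fun _ => 1)
      EventuallyEq.rfl, hM]
    simp [hL.le]
  · rw [energy_product p (-2 * k) (F := groundState c k) (G := groundStateDeriv c k)
      (h := fun _ => 1) (continuous_groundState c k) continuous_const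
      EventuallyEq.rfl EventuallyEq.rfl, hA, h0, hdy,
      integral_norm_groundState_rpow hc hk (by linarith)]
    simp only [one_pow, abs_one, Real.one_rpow, integral_Ioo_const hL]
    ring

/-- The energy of `√3 (y / L) F(x)`. -/
lemma exists_modulated_energy {p γ L : ℝ} (hp : 1 < p) (hL : 0 < L) {F G : ℝ → ℂ}
    (hP : IsPrimitive F G) (hF : MemLp F 2) (hG : MemLp G 2) :
    ∃ w : H1 L, mass w = (∫ x, ‖F x‖ ^ 2) * L ∧ energy p γ w =
      L * (1 / 2 * (∫ x, ‖G x‖ ^ 2) + γ / 2 * ‖F 0‖ ^ 2) + 3 / (2 * L) * (∫ x, ‖F x‖ ^ 2)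
      - 1 / (p + 1) * ((∫ x, ‖F x‖ ^ (p + 1)) * (Real.sqrt 3 ^ (p + 1) / (p + 2) * L)) := by
  have h3 : Real.sqrt 3 ^ 2 = 3 := Real.sq_sqrt (by norm_num)
  have hs : 0 ≤ Real.sqrt 3 := Real.sqrt_nonneg 3
  set a := Real.sqrt 3
  have hFc : Continuous F := hP.continuous (hG.locallyIntegrable one_le_two)
  -- The factor `√3` preserves the mass, since `(y/L)²` has integral `L/3` over `(0, L)`.
  let w : H1 L := productH1 L hP hF hG (h := fun y => a / L * y) (h' := fun _ => a / L)
    (fun y => by simpa using (hasDerivAt_id' y).const_mul (a / L)) continuous_const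
  have hh : ∫ y in Ioo 0 L, (a / L * y) ^ 2 = L := by
    rw [integral_Ioo_linear_sq hL hs, h3]
    field_simp
  have hdy : ∫ z in strip L, ‖w.dy z‖ ^ 2 = (∫ x, ‖F x‖ ^ 2) * (3 / L) := by
    rw [integral_strip_product_sq (v := w.dy) (F := F) (h := fun _ => a / L) EventuallyEq.rfl,
      integral_Ioo_const hL, div_pow, h3]
    field_simp
  refine ⟨w, ?_, ?_⟩
  · rw [mass, integral_strip_product_sq (v := w.toFun) (F := F) (h := fun y => a / L * y) EventuallyEq.rfl, hh]
  · rw [energy_product p γ (F := F) (G := G) (h := fun y => a / L * y) hFc (by fun_prop)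
      EventuallyEq.rfl EventuallyEq.rfl, hdy, hh,
      integral_Ioo_linear_rpow hL hs (by linarith)]
    rw [show p + 1 + 1 = p + 2 by ring]
    field_simp
    ring

/-- Strict Bernoulli: `(1 + 2)^((p+1)/2) > 1 + (p + 1)`, as the exponent exceeds one. -/
lemma one_lt_sqrt_three_rpow_div {p : ℝ} (hp : 1 < p) : 1 < Real.sqrt 3 ^ (p + 1) / (p + 2) := by
  rw [one_lt_div (by linarith), Real.sqrt_eq_rpow, ← Real.rpow_mul (by norm_num)]
  have := one_add_mul_self_lt_rpow_one_add (s := 2) (by norm_num) (by norm_num)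
    (p := (p + 1) / 2) (by linarith)
  rw [show (1 : ℝ) + 2 = 3 by norm_num] at this
  rw [show 1 / 2 * (p + 1) = (p + 1) / 2 by ring]
  linarith

end FracturedStrip

end

/-! ### Comparison of the energies. -/

open FracturedStrip in
theorem theorem5 (p γ : ℝ) (hp : 1 < p) (hp' : p < 3) (hγ : γ < 0) (mt : ℝ) (hmt : 0 < mt) :
    ∃ Lss : ℝ, 0 < Lss ∧ ∀ L : ℝ, Lss < L →
      ∀ u : FracturedStrip.H1 L, FracturedStrip.IsEnergyMinimizer p γ (mt * L) u →
        ¬ FracturedStrip.IndependentOfY u := by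
  obtain ⟨k, hk, rfl⟩ : ∃ k : ℝ, 0 < k ∧ γ = -2 * k := ⟨-γ / 2, by linarith, by ring⟩
  have hβ := one_lt_sqrt_three_rpow_div hp
  set β := Real.sqrt 3 ^ (p + 1) / (p + 2) with hβdef
  have hB : 0 < Real.sqrt (mt * k) ^ (p + 1) * (2 / ((p + 1) * k)) :=
    mul_pos (Real.rpow_pos_of_pos (Real.sqrt_pos.2 (mul_pos hmt hk)) _)
      (div_pos two_pos (mul_pos (by linarith) hk))
  set B₀ := Real.sqrt (mt * k) ^ (p + 1) * (2 / ((p + 1) * k)) with hB₀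
  have hp1 : 0 < 1 / (p + 1) := by exact one_div_pos.2 (by linarith)
  have hδ : 0 < 1 / (p + 1) * B₀ * (β - 1) := mul_pos (mul_pos hp1 hB) (by linarith)
  -- The summand `1` gives `L > 1`, so the transverse cost is at most `3 mt / 2`; the other makes
  -- the gain exceed this.
  refine ⟨1 + 3 / 2 * mt / (1 / (p + 1) * B₀ * (β - 1)), by positivity, ?_⟩
  intro L hLs u hu hind
  have hL1 : 1 < L := lt_of_le_of_lt (le_add_of_nonneg_right (by positivity)) hLs
  have hL : 0 < L := by linarith
  obtain ⟨F, G, hP, hF, hG, huF, hdx⟩ := exists_primitive_of_independentOfY hL hind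
  have hFc : Continuous F := hP.continuous (hG.locallyIntegrable one_le_two)
  have huF' : u.toFun =ᵐ[volume.restrict (strip L)] fun z => (fun _ => (1 : ℝ)) z.2 • F z.1 := by
    simpa using huF
  have hdx' : u.dx =ᵐ[volume.restrict (strip L)] fun z => (fun _ => (1 : ℝ)) z.2 • G z.1 := by
    simpa using hdx
  have hM : ∫ x, ‖F x‖ ^ 2 = mt := by
    have h1 := hu.1
    rw [mass, integral_strip_product_sq (F := F) (h := fun _ => 1) huF'] at h1
    simp only [one_pow, integral_Ioo_const hL, mul_one] at h1
    exact mul_right_cancel₀ hL.ne' h1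
  have hEu := energy_product p (-2 * k) (F := F) (G := G) (h := fun _ => 1) hFc continuous_const huF' hdx'
  simp only [one_pow, abs_one, Real.one_rpow, integral_Ioo_const hL, mul_one] at hEu
  have hdy : 0 ≤ ∫ z in strip L, ‖u.dy z‖ ^ 2 := integral_nonneg fun _ => by positivity
  have htr := hP.norm_sq_le hF hG hk
  obtain ⟨w, hwm, hwE⟩ := exists_ground_state_energy hp hk hmt hL
  obtain ⟨v, hvm, hvE⟩ := exists_modulated_energy (γ := -2 * k) hp hL hP hF hG
  rw [hM] at hvm hvE htr
  have h1 := hu.2 w hwm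
  have h2 := hu.2 v hvm
  rw [hwE, hEu, ← hB₀] at h1
  rw [hvE, hEu, ← hβdef] at h2
  generalize ∫ x, ‖G x‖ ^ 2 = A at *
  generalize ∫ x, ‖F x‖ ^ (p + 1) = B at *
  generalize 1 / (p + 1) = r at *
  -- Minimality against the ground state `w`: the quadratic part for `F` is no smaller (`htr`) and
  -- the `dy` term is nonnegative, so the nonlinear term must compensate.
  have hBB : r * B₀ ≤ r * B := by
    have : L * (r * B₀) ≤ L * (r * B) := by nlinarith
    exact le_of_mul_le_mul_left this hL
  -- Minimality against the modulated `v`: the quadratic parts in `x` cancel.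
  have h3 : L * (r * B * (β - 1)) ≤ 3 / (2 * L) * mt := by nlinarith
  have h4 : L * (r * B₀ * (β - 1)) ≤ 3 / (2 * L) * mt :=
    (mul_le_mul_of_nonneg_left (mul_le_mul_of_nonneg_right hBB (by linarith)) hL.le).trans h3
  have h5 : 3 / (2 * L) * mt ≤ 3 / 2 * mt := by
    refine mul_le_mul_of_nonneg_right ?_ hmt.le
    exact div_le_div_of_nonneg_left (by norm_num) (by norm_num) (by linarith)
  have h6 : 3 / 2 * mt < L * (r * B₀ * (β - 1)) := by
    rw [← div_lt_iff₀ hδ]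
    linarith
  linarith
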